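/- Let $N\ge 1$. Let $\mathcal O(U_N^+)$ be the universal $*$-algebra generated by $u_{ij}$ ($1\le i,j\le N$) such that $U=(u_{ij})$ and $\overline U=(u_{ij}^*)$ are unitary, with coproduct $\Delta(u_{ij})=\sum_k u_{ik}\otimes u_{kj}$ and counit $\varepsilon(u_{ij})=\delta_{ij}$. For a word $w=w_1\cdots w_\ell$ in two letters $\lozenge,\blacklozenge$, let $\chi_w$ be the character of $U_{w_1}\otimes\cdots\otimes U_{w_\ell}$, where $U_\lozenge=U$ and $U_\blacklozenge=\overline U$; let $\ell(w)$ be the length of $w$ and $p(w)$, $q(w)$ the numbers of letters $\lozenge$, $\blacklozenge$ in it. A generating functional is a hermitian linear form $L$ on $\mathcal O(U_N^+)$ with $L(1)=0$ that is positive on $\ker\varepsilon$, i.e. $L(a^*a)\ge0$ for $a\in\ker\varepsilon$. It is central if $L=L\circ\mathbb E$, where $\mathbb E$ is the conditional expectation, leaving the Haar state invariant, onto the subalgebra generated by the characters of the finite-dimensional representations. Let $\alpha,\beta\ge0$, and let $L$ be a Brownian motion on $U_N^+$ of parameter $(\alpha,\beta)$, i.e. a central generating functional such that for every word $w$ $$L(\chi_w)=-\ell(w)N^{\ell(w)-1}\alpha-\big((p(w)-q(w))^2-\ell(w)\big)N^{\ell(w)-2}\beta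 .$$ Let $P_0=1$, $P_1=X$, $XP_m=P_{m+1}+P_{m-1}$ ($m\ge1$). Let $\mathcal O(O_N^+)$ be the quotient of $\mathcal O(U_N^+)$ by the relations $u_{ij}=u_{ij}^*$, let $o_{ij}$ be the image of $u_{ij}$ in it, and put $\chi_m=P_m\big(\sum_i o_{ii}\big)$. Let $z$ be the identity function of $\mathbb T$, and consider the $*$-homomorphism $\mathcal O(U_N^+)\to\mathcal O(O_N^+)*\mathcal O(\mathbb T)$, $u_{ij}\mapsto o_{ij}z$. Let $p\ge1$, let $\mathbf n=(n_1,\dots,n_p)$ be a tuple of positive integers, let $\epsilon\in\{\pm1\}$, put $\epsilon_1=\epsilon$ and $\epsilon_{i+1}=(-1)^{n_i+1}\epsilon_i$, and let $$\chi^\epsilon_{\mathbf n}=z^{\min(\epsilon_1,0)}\chi_{n_1}z^{\epsilon_2}\chi_{n_2}\cdots z^{\epsilon_p}\chi_{n_p}z^{\max(\epsilon_{p+1},0)}$$ (for $N\ge2$ these elements are the characters of the nontrivial irreducible representations of $U_N^+$). Let $\mathfrak p_{\mathbf n}$ be the number of odd entries of $\mathbf n$, let $k_1<\dots<k_{\mathfrak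 p_{\mathbf n}}$ be their positions, and let $$\mathfrak e_{\mathbf n}=\sum_{1\le i<j\le\mathfrak p_{\mathbf n}}(-1)^{k_j+j-(k_i+i)}$$ be the parity entanglement. Put $P_{\mathbf n}=P_{n_1}\cdots P_{n_p}$. Then $\chi^\epsilon_{\mathbf n}$ is the image of exactly one element of $\mathcal O(U_N^+)$, again denoted by $\chi^\epsilon_{\mathbf n}$, and $$L(\chi^\epsilon_{\mathbf n})=-\Big(\alpha-\frac{\beta}{N}\Big)P_{\mathbf n}'(N)-\beta\,\frac{\mathfrak p_{\mathbf n}+2\mathfrak e_{\mathbf n}}{N^2}\,P_{\mathbf n}(N).$$ -/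

import Mathlib

namespace FreeUnitary

noncomputable section

open scoped ComplexOrder TensorProduct LaurentPolynomial

/-! ### The `*`-algebra of the free unitary quantum group -/

/-- Free generators: `(i, j, false)` stands for `u i j`, `(i, j, true)` for its adjoint. -/
abbrev Gen (N : ℕ) : Type := Fin N × Fin N × Bool

/-- The four families of defining relations. -/
inductive Rel (N : ℕ) : FreeAlgebra ℂ (Gen N) → FreeAlgebra ℂ (Gen N) → Prop
  | uu_star (i j : Fin N) : Rel N
      (∑ k, FreeAlgebra.ι ℂ (i, k, false) * FreeAlgebra.ι ℂ (j, k, true)) (if i = j then 1 else 0)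
  | star_uu (i j : Fin N) : Rel N
      (∑ k, FreeAlgebra.ι ℂ (k, i, true) * FreeAlgebra.ι ℂ (k, j, false)) (if i = j then 1 else 0)
  | conj_one (i j : Fin N) : Rel N
      (∑ k, FreeAlgebra.ι ℂ (i, k, true) * FreeAlgebra.ι ℂ (j, k, false)) (if i = j then 1 else 0)
  | conj_two (i j : Fin N) : Rel N
      (∑ k, FreeAlgebra.ι ℂ (k, i, false) * FreeAlgebra.ι ℂ (k, j, true)) (if i = j then 1 else 0)

/-- The algebra `O(U_N^+)`. Its involution is constructed below. -/
def OU (N : ℕ) : Type := RingQuot (Rel N)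

instance (N : ℕ) : Ring (OU N) := inferInstanceAs (Ring (RingQuot (Rel N)))
instance (N : ℕ) : Algebra ℂ (OU N) := inferInstanceAs (Algebra ℂ (RingQuot (Rel N)))

variable {N : ℕ}

/-- The quotient map from noncommutative polynomials. -/
def OU.mk (N : ℕ) : FreeAlgebra ℂ (Gen N) →ₐ[ℂ] OU N := RingQuot.mkAlgHom ℂ (Rel N)

/-- The generator `u i j`. -/
def u (i j : Fin N) : OU N := OU.mk N (FreeAlgebra.ι ℂ (i, j, false))

/-- The adjoint generator; see `star_u`. -/
def us (i j : Fin N) : OU N := OU.mk N (FreeAlgebra.ι ℂ (i, j, true))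

theorem sum_u_us (i j : Fin N) : ∑ k, u i k * us j k = if i = j then 1 else 0 := by
  have h : OU.mk N _ = OU.mk N _ := RingQuot.mkAlgHom_rel ℂ (Rel.uu_star i j)
  simpa [apply_ite (OU.mk N), u, us] using h

theorem sum_us_u (i j : Fin N) : ∑ k, us k i * u k j = if i = j then 1 else 0 := by
  have h : OU.mk N _ = OU.mk N _ := RingQuot.mkAlgHom_rel ℂ (Rel.star_uu i j)
  simpa [apply_ite (OU.mk N), u, us] using h

theorem sum_us_u' (i j : Fin N) : ∑ k, us i k * u j k = if i = j then 1 else 0 := by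
  have h : OU.mk N _ = OU.mk N _ := RingQuot.mkAlgHom_rel ℂ (Rel.conj_one i j)
  simpa [apply_ite (OU.mk N), u, us] using h

theorem sum_u_us' (i j : Fin N) : ∑ k, u k i * us k j = if i = j then 1 else 0 := by
  have h : OU.mk N _ = OU.mk N _ := RingQuot.mkAlgHom_rel ℂ (Rel.conj_two i j)
  simpa [apply_ite (OU.mk N), u, us] using h

/-- Universal property of `O(U_N^+)`. -/
def OU.lift {A : Type*} [Semiring A] [Algebra ℂ A] (a b : Fin N → Fin N → A)
    (h1 : ∀ i j, ∑ k, a i k * b j k = if i = j then 1 else 0)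
    (h2 : ∀ i j, ∑ k, b k i * a k j = if i = j then 1 else 0)
    (h3 : ∀ i j, ∑ k, b i k * a j k = if i = j then 1 else 0)
    (h4 : ∀ i j, ∑ k, a k i * b k j = if i = j then 1 else 0) : OU N →ₐ[ℂ] A :=
  RingQuot.liftAlgHom ℂ ⟨FreeAlgebra.lift ℂ (fun g => if g.2.2 then b g.1 g.2.1 else a g.1 g.2.1), by
    intro x y h
    cases h with
    | uu_star i j => simpa [apply_ite (FreeAlgebra.lift ℂ _)] using h1 i j
    | star_uu i j => simpa [apply_ite (FreeAlgebra.lift ℂ _)] using h2 i j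
    | conj_one i j => simpa [apply_ite (FreeAlgebra.lift ℂ _)] using h3 i j
    | conj_two i j => simpa [apply_ite (FreeAlgebra.lift ℂ _)] using h4 i j⟩

section lift
variable {A : Type*} [Semiring A] [Algebra ℂ A] (a b : Fin N → Fin N → A)
    (h1 : ∀ i j, ∑ k, a i k * b j k = if i = j then 1 else 0)
    (h2 : ∀ i j, ∑ k, b k i * a k j = if i = j then 1 else 0)
    (h3 : ∀ i j, ∑ k, b i k * a j k = if i = j then 1 else 0)
    (h4 : ∀ i j, ∑ k, a k i * b k j = if i = j then 1 else 0)

theorem OU.lift_u (i j : Fin N) : OU.lift a b h1 h2 h3 h4 (u i j) = a i j := by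
  unfold OU.lift u OU.mk
  erw [RingQuot.liftAlgHom_mkAlgHom_apply]
  simp

theorem OU.lift_us (i j : Fin N) : OU.lift a b h1 h2 h3 h4 (us i j) = b i j := by
  unfold OU.lift us OU.mk
  erw [RingQuot.liftAlgHom_mkAlgHom_apply]
  simp
end lift

theorem OU.hom_ext {A : Type*} [Semiring A] [Algebra ℂ A] {f g : OU N →ₐ[ℂ] A}
    (h : ∀ i j, f (u i j) = g (u i j)) (h' : ∀ i j, f (us i j) = g (us i j)) : f = g := by
  apply RingQuot.ringQuot_ext'
  apply FreeAlgebra.hom_ext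
  funext x
  obtain ⟨i, j, b⟩ := x
  cases b
  · exact h i j
  · exact h' i j

/-- The opposite algebra with complex-conjugated scalars; an algebra homomorphism into it is an
antilinear antimultiplicative map. -/
def ConjOp (A : Type*) : Type _ := Aᵐᵒᵖ

/-- The element of `ConjOp A` given by an element of `A`. -/
def ConjOp.op {A : Type*} (a : A) : ConjOp A := MulOpposite.op a

instance (A : Type*) [Ring A] : Ring (ConjOp A) := inferInstanceAs (Ring Aᵐᵒᵖ)

instance (A : Type*) [Ring A] [Algebra ℂ A] : Algebra ℂ (ConjOp A) :=
  RingHom.toAlgebra' (S := ConjOp A) ((algebraMap ℂ Aᵐᵒᵖ).comp (starRingEnd ℂ))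
    fun c x => Algebra.commutes (A := Aᵐᵒᵖ) (starRingEnd ℂ c) x

theorem op_rel (x y : Fin N → OU N) (i j : Fin N)
    (h : ∑ k, y k * x k = if j = i then 1 else 0) :
    ∑ k, ConjOp.op (x k) * ConjOp.op (y k) = if i = j then 1 else 0 := by
  have h' : ∑ k, (MulOpposite.op (x k) * MulOpposite.op (y k) : (OU N)ᵐᵒᵖ) =
      if i = j then 1 else 0 := by
    simp only [← MulOpposite.op_mul]
    rw [← Finset.op_sum, h]
    by_cases hij : i = j
    · simp [hij]
    · rw [if_neg hij, if_neg (Ne.symm hij), MulOpposite.op_zero]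
  exact h'

/-- The involution exchanging `u i j` and `us i j`. -/
def starHom (N : ℕ) : OU N →ₐ[ℂ] ConjOp (OU N) :=
  OU.lift (A := ConjOp (OU N))
    (fun i j => ConjOp.op (us i j)) (fun i j => ConjOp.op (u i j))
    (fun i j => op_rel _ _ i j (sum_u_us j i))
    (fun i j => op_rel _ _ i j (sum_us_u j i))
    (fun i j => op_rel _ _ i j (sum_us_u' j i))
    (fun i j => op_rel _ _ i j (sum_u_us' j i))

/-- The underlying map of the involution. -/
def starFun (x : OU N) : OU N := MulOpposite.unop (starHom N x : (OU N)ᵐᵒᵖ)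

theorem starFun_mul (x y : OU N) : starFun (x * y) = starFun y * starFun x := by
  unfold starFun
  rw [map_mul]
  rfl

theorem starFun_add (x y : OU N) : starFun (x + y) = starFun x + starFun y := by
  unfold starFun
  rw [map_add]
  rfl

theorem starFun_algebraMap (c : ℂ) :
    starFun (algebraMap ℂ (OU N) c) = algebraMap ℂ (OU N) (starRingEnd ℂ c) := by
  unfold starFun
  rw [AlgHom.commutes]
  rfl

theorem starFun_u (i j : Fin N) : starFun (u i j) = us i j := by
  unfold starFun starHom
  rw [OU.lift_u]
  rfl

theorem starFun_us (i j : Fin N) : starFun (us i j) = u i j := by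
  unfold starFun starHom
  rw [OU.lift_us]
  rfl

theorem starFun_starFun (x : OU N) : starFun (starFun x) = x := by
  let F : OU N →ₐ[ℂ] OU N :=
    { toFun := fun x => starFun (starFun x)
      map_one' := by
        have := starFun_algebraMap (N := N) 1
        simp only [map_one] at this
        rw [this, this]
      map_mul' := fun x y => by rw [starFun_mul, starFun_mul]
      map_zero' := by
        have := starFun_algebraMap (N := N) 0
        simp only [map_zero] at this
        rw [this, this]
      map_add' := fun x y => by rw [starFun_add, starFun_add]
      commutes' := fun c => by rw [starFun_algebraMap, starFun_algebraMap]; simp }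
  have hF : F = AlgHom.id ℂ (OU N) := OU.hom_ext
    (fun i j => by change starFun (starFun (u i j)) = u i j; rw [starFun_u, starFun_us])
    (fun i j => by change starFun (starFun (us i j)) = us i j; rw [starFun_us, starFun_u])
  exact DFunLike.congr_fun hF x

instance (N : ℕ) : StarRing (OU N) where
  star := starFun
  star_involutive := starFun_starFun
  star_mul := starFun_mul
  star_add := starFun_add

instance (N : ℕ) : StarModule ℂ (OU N) where
  star_smul c x := by
    change starFun (c • x) = star c • starFun x
    rw [Algebra.smul_def, starFun_mul, starFun_algebraMap, Algebra.smul_def]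
    exact (Algebra.commutes _ _).symm

theorem star_u (i j : Fin N) : star (u i j) = us i j := starFun_u i j

theorem star_us (i j : Fin N) : star (us i j) = u i j := starFun_us i j

/-! ### Coproduct, counit, representations and characters -/

/-- The counit, `u i j ↦ δ_ij`. -/
def counit (N : ℕ) : OU N →ₐ[ℂ] ℂ :=
  OU.lift (fun i j => if i = j then 1 else 0) (fun i j => if i = j then 1 else 0)
    (fun i j => by
      simp only [ite_mul, one_mul, zero_mul, Finset.sum_ite_eq, Finset.mem_univ, if_true]
      exact if_congr eq_comm rfl rfl)
    (fun i j => by simpa using if_congr eq_comm rfl rfl)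
    (fun i j => by
      simp only [ite_mul, one_mul, zero_mul, Finset.sum_ite_eq, Finset.mem_univ, if_true]
      exact if_congr eq_comm rfl rfl)
    (fun i j => by simpa using if_congr eq_comm rfl rfl)

theorem comul_rel_left (p q : Fin N → OU N) (r s : Fin N → Fin N → OU N) (P : Prop) [Decidable P]
    (hrs : ∀ a b, ∑ k, r a k * s b k = if a = b then 1 else 0)
    (hpq : ∑ a, p a * q a = if P then 1 else 0) :
    ∑ k, (∑ a, p a ⊗ₜ[ℂ] r a k) * (∑ b, q b ⊗ₜ[ℂ] s b k) = if P then 1 else 0 := by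
  simp only [Finset.sum_mul_sum, Algebra.TensorProduct.tmul_mul_tmul]
  rw [Finset.sum_comm]
  have h : ∀ a, ∑ k, ∑ b, (p a * q b) ⊗ₜ[ℂ] (r a k * s b k) = (p a * q a) ⊗ₜ[ℂ] (1 : OU N) := by
    intro a
    rw [Finset.sum_comm]
    simp only [← TensorProduct.tmul_sum, hrs]
    rw [Finset.sum_eq_single a]
    · simp
    · intro b _ hb
      rw [if_neg (Ne.symm hb), TensorProduct.tmul_zero]
    · simp
  simp only [h]
  rw [← TensorProduct.sum_tmul, hpq]
  split_ifs
  · rfl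
  · rw [TensorProduct.zero_tmul]

theorem comul_rel_right (p q : Fin N → Fin N → OU N) (r s : Fin N → OU N) (P : Prop) [Decidable P]
    (hpq : ∀ a b, ∑ k, p k a * q k b = if a = b then 1 else 0)
    (hrs : ∑ a, r a * s a = if P then 1 else 0) :
    ∑ k, (∑ a, p k a ⊗ₜ[ℂ] r a) * (∑ b, q k b ⊗ₜ[ℂ] s b) = if P then 1 else 0 := by
  simp only [Finset.sum_mul_sum, Algebra.TensorProduct.tmul_mul_tmul]
  rw [Finset.sum_comm]
  have h : ∀ a, ∑ k, ∑ b, (p k a * q k b) ⊗ₜ[ℂ] (r a * s b) = (1 : OU N) ⊗ₜ[ℂ] (r a * s a) := by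
    intro a
    rw [Finset.sum_comm]
    simp only [← TensorProduct.sum_tmul, hpq]
    rw [Finset.sum_eq_single a]
    · simp
    · intro b _ hb
      rw [if_neg (Ne.symm hb), TensorProduct.zero_tmul]
    · simp
  simp only [h]
  rw [← TensorProduct.tmul_sum, hrs]
  split_ifs
  · rfl
  · rw [TensorProduct.tmul_zero]

/-- The coproduct, `u i j ↦ ∑ k, u i k ⊗ u k j`. -/
def comul (N : ℕ) : OU N →ₐ[ℂ] OU N ⊗[ℂ] OU N :=
  OU.lift (fun i j => ∑ k, u i k ⊗ₜ[ℂ] u k j) (fun i j => ∑ k, us i k ⊗ₜ[ℂ] us k j)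
    (fun i j => comul_rel_left _ _ (fun a k => u a k) (fun b k => us b k) _ sum_u_us (sum_u_us i j))
    (fun i j => comul_rel_right (fun k a => us k a) (fun k b => u k b) _ _ _ sum_us_u
      (sum_us_u i j))
    (fun i j => comul_rel_left _ _ (fun a k => us a k) (fun b k => u b k) _ sum_us_u'
      (sum_us_u' i j))
    (fun i j => comul_rel_right (fun k a => u k a) (fun k b => us k b) _ _ _ sum_u_us'
      (sum_u_us' i j))

/-- A finite-dimensional representation of `U_N^+`, as the matrix of its coefficients. -/
structure IsRepresentation {ι : Type} [Fintype ι] [DecidableEq ι] (v : Matrix ι ι (OU N)) :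
    Prop where
  comul_apply : ∀ i j, comul N (v i j) = ∑ k, v i k ⊗ₜ[ℂ] v k j
  counit_apply : ∀ i j, counit N (v i j) = if i = j then 1 else 0

/-- The central algebra `O(U_N^+)_0`: the algebra generated by the characters (traces) of the
finite-dimensional representations. -/
def centralAlgebra (N : ℕ) : Subalgebra ℂ (OU N) :=
  Algebra.adjoin ℂ
    {x | ∃ (d : ℕ) (v : Matrix (Fin d) (Fin d) (OU N)), IsRepresentation v ∧ x = v.trace}

/-! ### States, central generating functionals, Brownian motion -/

/-- A state: a unital positive linear form. -/
structure IsState (φ : OU N →ₗ[ℂ] ℂ) : Prop where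
  map_one : φ 1 = 1
  nonneg : ∀ a, 0 ≤ φ (star a * a)

/-- The Haar state: `(id ⊗ h) Δ(x) = h(x) 1 = (h ⊗ id) Δ(x)`. -/
structure IsHaarState (h : OU N →ₗ[ℂ] ℂ) : Prop where
  isState : IsState h
  right_inv : ∀ x, TensorProduct.rid ℂ (OU N) (h.lTensor (OU N) (comul N x)) = h x • 1
  left_inv : ∀ x, TensorProduct.lid ℂ (OU N) (h.rTensor (OU N) (comul N x)) = h x • 1

/-- `E` is a conditional expectation onto the central algebra leaving `h` invariant. Positivity of
an element is understood in the universal enveloping C*-algebra, hence tested on all states. -/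
structure IsConditionalExpectation (h : OU N →ₗ[ℂ] ℂ) (E : OU N →ₗ[ℂ] OU N) : Prop where
  mem : ∀ a, E a ∈ centralAlgebra N
  nonneg : ∀ φ : OU N →ₗ[ℂ] ℂ, IsState φ → ∀ a, 0 ≤ φ (E (star a * a))
  apply_of_mem : ∀ b ∈ centralAlgebra N, E b = b
  bimodule : ∀ a, ∀ b ∈ centralAlgebra N, ∀ b' ∈ centralAlgebra N, E (b * a * b') = b * E a * b'
  invariant : ∀ a, h (E a) = h a

/-- A generating functional: hermitian, zero at `1`, positive on the kernel of the counit. -/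
structure IsGeneratingFunctional (L : OU N →ₗ[ℂ] ℂ) : Prop where
  hermitian : ∀ a, L (star a) = star (L a)
  map_one : L 1 = 0
  nonneg : ∀ a, counit N a = 0 → 0 ≤ L (star a * a)

/-- `L = L ∘ E`, with `E` the conditional expectation onto the central algebra that leaves the Haar
state invariant. -/
def IsCentral (L : OU N →ₗ[ℂ] ℂ) : Prop :=
  ∃ (h : OU N →ₗ[ℂ] ℂ) (E : OU N →ₗ[ℂ] OU N),
    IsHaarState h ∧ IsConditionalExpectation h E ∧ L = L ∘ₗ E

/-- `U` for the white letter (`true`), the entrywise adjoint of `U` for the black one (`false`). -/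
def letterRep (c : Bool) : Matrix (Fin N) (Fin N) (OU N) :=
  Matrix.of fun i j => if c then u i j else star (u i j)

/-- The tensor product `U_w = U_{w_1} ⊗ ... ⊗ U_{w_ℓ}`. -/
def wordRep (w : List Bool) :
    Matrix (Fin w.length → Fin N) (Fin w.length → Fin N) (OU N) :=
  Matrix.of fun i j => (List.ofFn fun k => letterRep (w.get k) (i k) (j k)).prod

/-- The character `χ_w` of `U_w`. -/
def wordChar (N : ℕ) (w : List Bool) : OU N := (wordRep w).trace

/-- `L` is a Brownian motion on `U_N^+` with parameter `(α, β)`. -/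
structure IsBrownianMotion (α β : ℝ) (L : OU N →ₗ[ℂ] ℂ) : Prop where
  nonneg_left : 0 ≤ α
  nonneg_right : 0 ≤ β
  generating : IsGeneratingFunctional L
  central : IsCentral L
  apply_word : ∀ w : List Bool, L (wordChar N w) =
    -(w.length : ℂ) * (N : ℂ) ^ ((w.length : ℤ) - 1) * α
      - (((w.count true : ℂ) - (w.count false : ℂ)) ^ 2 - (w.length : ℂ))
        * (N : ℂ) ^ ((w.length : ℤ) - 2) * β

/-! ### The embedding into `O(O_N^+) * O(𝕋)` and the characters -/

/-- The algebra `O(O_N^+)`, the quotient of `O(U_N^+)` by the relations `u i j = (u i j)^*`. -/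
def OO (N : ℕ) : Type := RingQuot fun x y : OU N => ∃ i j, x = u i j ∧ y = star (u i j)

instance (N : ℕ) : Ring (OO N) :=
  inferInstanceAs (Ring (RingQuot fun x y : OU N => ∃ i j, x = u i j ∧ y = star (u i j)))
instance (N : ℕ) : Algebra ℂ (OO N) :=
  inferInstanceAs (Algebra ℂ (RingQuot fun x y : OU N => ∃ i j, x = u i j ∧ y = star (u i j)))

/-- The quotient map `O(U_N^+) → O(O_N^+)`. -/
def OO.mk (N : ℕ) : OU N →ₐ[ℂ] OO N :=
  RingQuot.mkAlgHom ℂ fun x y : OU N => ∃ i j, x = u i j ∧ y = star (u i j)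

/-- The generator `o i j`. -/
def o (i j : Fin N) : OO N := OO.mk N (u i j)

theorem OO.mk_u (i j : Fin N) : OO.mk N (u i j) = o i j := rfl

theorem OO.mk_us (i j : Fin N) : OO.mk N (us i j) = o i j := by
  have h : OO.mk N (u i j) = OO.mk N (star (u i j)) := RingQuot.mkAlgHom_rel ℂ ⟨i, j, rfl, rfl⟩
  rw [← star_u, ← h]
  rfl

theorem sum_o_o (i j : Fin N) : ∑ k, o i k * o j k = if i = j then 1 else 0 := by
  have h := congrArg (OO.mk N) (sum_u_us i j)
  simpa [apply_ite (OO.mk N), OO.mk_u, OO.mk_us] using h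

theorem sum_o_o' (i j : Fin N) : ∑ k, o k i * o k j = if i = j then 1 else 0 := by
  have h := congrArg (OO.mk N) (sum_us_u i j)
  simpa [apply_ite (OO.mk N), OO.mk_u, OO.mk_us] using h

/-- The two factors of the free product: `O(O_N^+)` (at `false`) and the algebra `O(𝕋)` of Laurent
polynomials in `z` (at `true`). -/
def Factor (N : ℕ) (b : Bool) : Type := cond b ℂ[T;T⁻¹] (OO N)

instance (N : ℕ) : (b : Bool) → Semiring (Factor N b)
  | true => inferInstanceAs (Semiring ℂ[T;T⁻¹])
  | false => inferInstanceAs (Semiring (OO N))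

instance (N : ℕ) : (b : Bool) → Algebra ℂ (Factor N b)
  | true => inferInstanceAs (Algebra ℂ ℂ[T;T⁻¹])
  | false => inferInstanceAs (Algebra ℂ (OO N))

/-- The free product `O(O_N^+) * O(𝕋)`. -/
abbrev FP (N : ℕ) : Type := LinearAlgebra.FreeProduct ℂ (Factor N)

/-- The inclusion of `O(O_N^+)` in the free product. -/
def inO (N : ℕ) : OO N →ₐ[ℂ] FP N := LinearAlgebra.FreeProduct.ι ℂ (Factor N) false

/-- The inclusion of `O(𝕋)` in the free product. -/
def inT (N : ℕ) : ℂ[T;T⁻¹] →ₐ[ℂ] FP N := LinearAlgebra.FreeProduct.ι ℂ (Factor N) true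

/-- The power `z ^ m`, `m ∈ ℤ`, in the free product. -/
def zpow (N : ℕ) (m : ℤ) : FP N := inT N (LaurentPolynomial.T m)

theorem zpow_mul_zpow (a b : ℤ) : zpow N a * zpow N b = zpow N (a + b) := by
  unfold zpow
  rw [LaurentPolynomial.T_add, map_mul]

theorem zpow_zero : zpow N 0 = 1 := by
  unfold zpow
  rw [LaurentPolynomial.T_zero, map_one]

theorem sum_inO (i j : Fin N) : ∑ k, inO N (o i k) * inO N (o j k) = if i = j then 1 else 0 := by
  have h := congrArg (inO N) (sum_o_o i j)
  simpa [apply_ite (inO N)] using h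

theorem sum_inO' (i j : Fin N) : ∑ k, inO N (o k i) * inO N (o k j) = if i = j then 1 else 0 := by
  have h := congrArg (inO N) (sum_o_o' i j)
  simpa [apply_ite (inO N)] using h

theorem z_cancel (x y : FP N) : x * zpow N 1 * (zpow N (-1) * y) = x * y := by
  rw [mul_assoc, ← mul_assoc (zpow N 1), zpow_mul_zpow, add_neg_cancel, zpow_zero, one_mul]

theorem z_conj (x y : Fin N → FP N) (P : Prop) [Decidable P]
    (h : ∑ k, x k * y k = if P then 1 else 0) :
    ∑ k, zpow N (-1) * x k * (y k * zpow N 1) = if P then 1 else 0 := by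
  have : ∀ k, zpow N (-1) * x k * (y k * zpow N 1) = zpow N (-1) * (x k * y k) * zpow N 1 := by
    intro k
    simp only [mul_assoc]
  simp only [this]
  rw [← Finset.sum_mul, ← Finset.mul_sum, h]
  split_ifs
  · rw [mul_one, zpow_mul_zpow, neg_add_cancel, zpow_zero]
  · rw [mul_zero, zero_mul]

/-- The canonical `*`-homomorphism `O(U_N^+) → O(O_N^+) * O(𝕋)`, `u i j ↦ o i j * z`
(so that the adjoint of `u i j` is sent to `z⁻¹ * o i j`). -/
def glue (N : ℕ) : OU N →ₐ[ℂ] FP N :=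
  OU.lift (fun i j => inO N (o i j) * zpow N 1) (fun i j => zpow N (-1) * inO N (o i j))
    (fun i j => by simp only [z_cancel, sum_inO])
    (fun i j => z_conj _ _ _ (sum_inO' i j))
    (fun i j => z_conj _ _ _ (sum_inO i j))
    (fun i j => by simp only [z_cancel, sum_inO'])

/-- The character `χ_m = P_m(χ_1)` of `O_N^+`, with `χ_1 = ∑ i, o i i`. Here `P_m` is the rescaled
Chebyshev polynomial: `P_0 = 1`, `P_1 = X`, `X P_m = P_{m+1} + P_{m-1}`. -/
def orthChar (N m : ℕ) : FP N :=
  inO N (Polynomial.aeval (∑ i, o i i : OO N) (Polynomial.Chebyshev.S ℂ m))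

/-- For `ε = ε_i`, `i ≥ 2`, the product `z^{ε_i} χ_{n_i} z^{ε_{i+1}} ⋯ χ_{n_p} z^{[ε_{p+1}]_+}`,
where `ε_{i+1} = (-1)^{n_i+1} ε_i`. -/
def charTail (N : ℕ) : ℤ → List ℕ → FP N
  | ε, [] => zpow N (max ε 0)
  | ε, m :: n => zpow N ε * orthChar N m * charTail N ((-1) ^ (m + 1) * ε) n

/-- The element `χ^ε_n = z^{[ε_1]_-} χ_{n_1} z^{ε_2} ⋯ z^{ε_p} χ_{n_p} z^{[ε_{p+1}]_+}`. -/
def freeChar (N : ℕ) : ℤ → List ℕ → FP N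
  | _, [] => 1
  | ε, m :: n => zpow N (min ε 0) * orthChar N m * charTail N ((-1) ^ (m + 1) * ε) n

/-! ### Combinatorial quantities attached to a tuple -/

/-- `P_n = P_{n_1} ⋯ P_{n_p}`. -/
def chebProd (n : List ℕ) : Polynomial ℝ :=
  (n.map fun m : ℕ => Polynomial.Chebyshev.S ℝ (m : ℤ)).prod

/-- The increasing list `k` of the positions of the odd entries of `n`. Positions, and indices in
`k`, are numbered from `0`; this does not change the parity of `k_i + i`. -/
def oddPositions (n : List ℕ) : List ℕ :=
  (List.range n.length).filter fun j => decide (Odd (n.getD j 0))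

/-- The number `𝔭_n` of odd entries of `n`. -/
def numOdd (n : List ℕ) : ℕ := n.countP fun m => decide (Odd m)

/-- The parity entanglement `𝔢_n = ∑_{i < j} (-1)^{k_j + j - (k_i + i)}`, where `i` and `j` range over
the indices of the odd entries. As `k` is increasing, the subtraction does not truncate. -/
def entanglement (n : List ℕ) : ℤ :=
  ∑ j : Fin (oddPositions n).length, ∑ i : Fin (oddPositions n).length,
    if i < j then
      (-1) ^ ((oddPositions n).get j + (j : ℕ) - ((oddPositions n).get i + (i : ℕ)))
    else 0

end

end FreeUnitary

namespace FreeUnitary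

noncomputable section

open scoped ComplexOrder TensorProduct LaurentPolynomial

variable {N : ℕ}

/-! Uniqueness is injectivity of `glue`. Let `x ↦ x̄` be the automorphism exchanging `u i j` and its
adjoint. The free product acts on `OU N`: `o i j` by `x ↦ u i j * x̄` and `z` by `x ↦ x̄`. Then `o i
j * z` acts as left multiplication by `u i j`, so `glue N x` acts as left multiplication by `x`, and
its value at `1` recovers `x` (`act_glue`).

Existence comes from an explicit preimage: the Chebyshev recursion is run along alternating words,
where the inner powers of `z` cancel (`glue_altChar`, `glue_tupleChar`).

For the value, a word of length `ℓ` and degree `k = p(w) - q(w)` satisfies, with `P = X ^ ℓ`,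
`L(χ_w) = -(α - β/N) P'(N) - β k² P(N) / N²`. For fixed `k` this is linear in `P`. The preimage of
`χ^ε_n` is a combination of words of one common degree `k`, whose polynomial is `P_n`, so the same
formula holds for it (`hasSymbol_tupleChar`). Finally `k = ± ∑ (-1)^(k_i + i)` over the odd entries,
and expanding the square gives `k² = 𝔭_n + 2 𝔢_n` (`sq_tupleDegree`). -/

/-! ### Injectivity of the gluing homomorphism -/

/-- The algebra endomorphism of `O(U_N^+)` exchanging `u i j` and its adjoint. -/
def conjHom (N : ℕ) : OU N →ₐ[ℂ] OU N :=
  OU.lift (fun i j => us i j) (fun i j => u i j) sum_us_u' sum_u_us' sum_u_us sum_us_u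

theorem conjHom_u (i j : Fin N) : conjHom N (u i j) = us i j := OU.lift_u ..

theorem conjHom_us (i j : Fin N) : conjHom N (us i j) = u i j := OU.lift_us ..

theorem conjHom_conjHom (x : OU N) : conjHom N (conjHom N x) = x := by
  have h : (conjHom N).comp (conjHom N) = AlgHom.id ℂ (OU N) := OU.hom_ext
    (fun i j => by simp [conjHom_u, conjHom_us]) (fun i j => by simp [conjHom_u, conjHom_us])
  exact DFunLike.congr_fun h x

/-- The involution `conjHom` as a unit of the algebra of linear endomorphisms. -/
def conjUnit (N : ℕ) : (Module.End ℂ (OU N))ˣ where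
  val := (conjHom N).toLinearMap
  inv := (conjHom N).toLinearMap
  val_inv := LinearMap.ext conjHom_conjHom
  inv_val := LinearMap.ext conjHom_conjHom

/-- The operator by which `o i j` acts on `O(U_N^+)`. -/
def orthAct (i j : Fin N) : Module.End ℂ (OU N) :=
  LinearMap.mulLeft ℂ (u i j) ∘ₗ (conjHom N).toLinearMap

theorem orthAct_apply (i j : Fin N) (x : OU N) : orthAct i j x = u i j * conjHom N x := rfl

/-- In a product of two operators the inner `conjHom` turns `u k l` into `us k l` and then cancels,
so the orthogonality relations for `orthAct` reduce to unitarity relations for `u`. -/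
theorem orthAct_mul_apply (i j k l : Fin N) (x : OU N) :
    (orthAct i j * orthAct k l) x = u i j * us k l * x := by
  rw [Module.End.mul_apply, orthAct_apply, orthAct_apply, map_mul, conjHom_u, conjHom_conjHom,
    mul_assoc]

theorem sum_orthAct (i j : Fin N) :
    ∑ k, orthAct i k * orthAct j k = if i = j then 1 else 0 := by
  ext x
  rw [LinearMap.sum_apply]
  simp only [orthAct_mul_apply]
  rw [← Finset.sum_mul, sum_u_us]
  split_ifs <;> simp

theorem sum_orthAct' (i j : Fin N) :
    ∑ k, orthAct k i * orthAct k j = if i = j then 1 else 0 := by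
  ext x
  rw [LinearMap.sum_apply]
  simp only [orthAct_mul_apply]
  rw [← Finset.sum_mul, sum_u_us']
  split_ifs <;> simp

/-- The representation of `O(O_N^+)` on `O(U_N^+)`. -/
def actO (N : ℕ) : OO N →ₐ[ℂ] Module.End ℂ (OU N) :=
  RingQuot.liftAlgHom ℂ ⟨OU.lift orthAct orthAct sum_orthAct sum_orthAct' sum_orthAct
    sum_orthAct', by
      rintro _ _ ⟨i, j, rfl, rfl⟩
      rw [star_u, OU.lift_u, OU.lift_us]⟩

theorem actO_o (i j : Fin N) : actO N (o i j) = orthAct i j := by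
  unfold actO o OO.mk
  erw [RingQuot.liftAlgHom_mkAlgHom_apply]
  exact OU.lift_u ..

/-- The representation of `O(𝕋)` on `O(U_N^+)`, in which `z` acts by `conjHom`. -/
def actT (N : ℕ) : ℂ[T;T⁻¹] →ₐ[ℂ] Module.End ℂ (OU N) :=
  AddMonoidAlgebra.lift ℂ (Module.End ℂ (OU N)) ℤ
    ((Units.coeHom _).comp (zpowersHom _ (conjUnit N)))

theorem actT_T (m : ℤ) : actT N (LaurentPolynomial.T m) = ((conjUnit N ^ m : _ˣ) : Module.End ℂ _) := by
  unfold actT LaurentPolynomial.T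
  rw [AddMonoidAlgebra.lift_single]
  simp

/-- The representation of the free product on `O(U_N^+)`. -/
def act (N : ℕ) : FP N →ₐ[ℂ] Module.End ℂ (OU N) :=
  LinearAlgebra.FreeProduct.lift ℂ (Factor N) fun {b} => match b with
    | true => actT N
    | false => actO N

theorem act_inO (x : OO N) : act N (inO N x) = actO N x :=
  DFunLike.congr_fun (LinearAlgebra.FreeProduct.lift_comp_ι ℂ (Factor N) (i := false) ..) x

theorem act_inT (x : ℂ[T;T⁻¹]) : act N (inT N x) = actT N x :=
  DFunLike.congr_fun (LinearAlgebra.FreeProduct.lift_comp_ι ℂ (Factor N) (i := true) ..) x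

theorem act_glue (x : OU N) : act N (glue N x) = LinearMap.mulLeft ℂ x := by
  have h : (act N).comp (glue N) = Algebra.lmul ℂ (OU N) := by
    apply OU.hom_ext
    · intro i j
      rw [AlgHom.comp_apply, glue, OU.lift_u, map_mul, act_inO, zpow, act_inT, actO_o, actT_T]
      ext x
      rw [Module.End.mul_apply, orthAct_apply, zpow_one]
      exact congrArg (u i j * ·) (conjHom_conjHom x)
    · intro i j
      rw [AlgHom.comp_apply, glue, OU.lift_us, map_mul, act_inO, zpow, act_inT, actO_o, actT_T]
      ext x
      rw [Module.End.mul_apply, orthAct_apply, zpow_neg_one]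
      change conjHom N (u i j * conjHom N x) = us i j * x
      rw [map_mul, conjHom_u, conjHom_conjHom]
  exact DFunLike.congr_fun h x

theorem glue_injective (N : ℕ) : Function.Injective (glue N) := by
  intro x y h
  -- Left multiplication by `x` determines `x` by its value at `1`.
  have h' := congrArg (fun f => f 1) ((act_glue x).symm.trans (h ▸ act_glue y))
  simpa using h'

/-! ### Word characters as products -/

/-- Distributivity with the order of the factors preserved; it makes the trace of a tensor product
the product of the traces. -/
theorem sum_prod_ofFn {A ι : Type*} [Semiring A] [Fintype ι] :
    ∀ {n : ℕ} (f : Fin n → ι → A), ∑ i : Fin n → ι, (List.ofFn fun k => f k (i k)).prod =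
      (List.ofFn fun k => ∑ a, f k a).prod
  | 0, f => by simp
  | n + 1, f => by
    rw [← (Fin.consEquiv fun _ => ι).sum_comp, Fintype.sum_prod_type]
    simp only [List.ofFn_succ, List.prod_cons, ← sum_prod_ofFn, Finset.sum_mul_sum]
    simp [Fin.consEquiv]

/-- The character of a single letter. -/
def letterChar (N : ℕ) (c : Bool) : OU N := (letterRep c).trace

theorem wordChar_eq_prod (w : List Bool) : wordChar N w = (w.map (letterChar N)).prod := by
  have h := sum_prod_ofFn (A := OU N) fun (k : Fin w.length) a => letterRep (w.get k) a a
  refine h.trans ?_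
  conv_rhs => rw [← List.ofFn_get w, List.map_ofFn]
  rfl

theorem wordChar_append_singleton (w : List Bool) (c : Bool) :
    wordChar N (w ++ [c]) = wordChar N w * letterChar N c := by
  simp [wordChar_eq_prod]

/-! ### Preimages of the characters -/

/-- The sign of a letter. -/
def letterSign (c : Bool) : ℤ := if c then 1 else -1

/-- The letter following an alternating word of length `m` that starts with `c`,
after the change of orientation: `ε ↦ (-1) ^ (m + 1) * ε` on signs. -/
def nextLetter (c : Bool) (m : ℕ) : Bool := if Even m then !c else c

theorem letterSign_not (c : Bool) : letterSign (!c) = -letterSign c := by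
  cases c <;> simp [letterSign]

theorem letterSign_sq (c : Bool) : letterSign c ^ 2 = 1 := by
  cases c <;> simp [letterSign]

theorem letterSign_nextLetter (c : Bool) (m : ℕ) :
    letterSign (nextLetter c m) = (-1) ^ (m + 1) * letterSign c := by
  unfold nextLetter
  split_ifs with h
  · rw [h.add_one.neg_one_pow, letterSign_not, neg_one_mul]
  · rw [(Nat.not_even_iff_odd.1 h).add_one.neg_one_pow, one_mul]

theorem nextLetter_add_two (c : Bool) (m : ℕ) : nextLetter c (m + 2) = nextLetter c m := by
  simp [nextLetter, Nat.even_add]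

theorem nextLetter_add_one (c : Bool) (m : ℕ) : nextLetter c (m + 1) = nextLetter (!c) m := by
  by_cases h : Even m <;> simp [nextLetter, Nat.even_add, h]

/-- The preimage of the character attached to the one-entry tuple `(m)`: the Chebyshev recursion
along an alternating word starting with the letter `c`. -/
def altChar (N : ℕ) : Bool → ℕ → OU N
  | _, 0 => 1
  | c, 1 => letterChar N c
  | c, m + 2 => letterChar N c * altChar N (!c) (m + 1) - altChar N c m

/-- The preimage of the character attached to a tuple. -/
def tupleChar (N : ℕ) : Bool → List ℕ → OU N
  | _, [] => 1
  | c, m :: n => altChar N c m * tupleChar N (nextLetter c m) n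

theorem orthChar_zero : orthChar N 0 = 1 := by simp [orthChar]

theorem orthChar_one : orthChar N 1 = ∑ i, inO N (o i i) := by simp [orthChar]

theorem orthChar_add_two (m : ℕ) :
    orthChar N (m + 2) + orthChar N m = orthChar N 1 * orthChar N (m + 1) := by
  unfold orthChar
  rw [← map_add, ← map_mul, ← map_add, ← map_mul]
  congr 2
  have := Polynomial.Chebyshev.S_add_two ℂ m
  push_cast
  rw [this, Polynomial.Chebyshev.S_one, sub_add_cancel]

theorem glue_letterChar (c : Bool) : glue N (letterChar N c) =
    zpow N (min (letterSign c) 0) * orthChar N 1 * zpow N (max (letterSign c) 0) := by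
  rw [orthChar_one]
  cases c
  · simp [letterChar, letterRep, Matrix.trace, letterSign, star_u, glue, OU.lift_us, zpow_zero,
      Finset.mul_sum]
  · simp [letterChar, letterRep, Matrix.trace, letterSign, glue, OU.lift_u, zpow_zero,
      Finset.sum_mul]

/-- The right power of `z` of a letter cancels the left power of the opposite letter, so the
recursion for `altChar` is mapped to that of `orthChar`; both terms carry the same outer powers
because `m` and `m + 2` have the same parity. -/
theorem glue_altChar : ∀ (c : Bool) (m : ℕ), glue N (altChar N c m) =
    zpow N (min (letterSign c) 0) * orthChar N m * zpow N (max (letterSign (nextLetter c m)) 0)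
  | c, 0 => by
    rw [altChar, orthChar_zero, mul_one, zpow_mul_zpow, map_one, ← zpow_zero]
    congr 1
    cases c <;> simp [letterSign, nextLetter]
  | c, 1 => by
    rw [altChar, glue_letterChar]
    simp [nextLetter]
  | c, m + 2 => by
    -- `FP N` carries only a semiring structure; subtraction comes from the scalar `-1` and is used
    -- only to cancel a summand.
    let _ : Ring (FP N) := Algebra.semiringToRing ℂ
    apply add_right_cancel (b := glue N (altChar N c m))
    rw [← map_add, altChar, sub_add_cancel, map_mul, glue_letterChar, glue_altChar (!c) (m + 1),
      glue_altChar c m, nextLetter_add_two, nextLetter_add_one, Bool.not_not, ← add_mul, ← mul_add,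
      orthChar_add_two]
    have h : zpow N (max (letterSign c) 0) * zpow N (min (letterSign !c) 0) = 1 := by
      rw [zpow_mul_zpow, ← zpow_zero]
      congr 1
      cases c <;> simp [letterSign]
    simp only [mul_assoc]
    rw [← mul_assoc (zpow N (max _ _)), h, one_mul]

/-- Each exponent splits as `ε = max ε 0 + min ε 0`: the first part closes the preceding block, the
second opens the next one. Thus `freeChar` factors into blocks, one per entry. -/
theorem charTail_eq (ε : ℤ) (n : List ℕ) :
    charTail N ε n = zpow N (max ε 0) * freeChar N ε n := by
  cases n with
  | nil => simp [charTail, freeChar]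
  | cons m n =>
    rw [charTail, freeChar, ← mul_assoc, ← mul_assoc, zpow_mul_zpow, max_add_min, add_zero]

theorem glue_tupleChar (c : Bool) (n : List ℕ) :
    glue N (tupleChar N c n) = freeChar N (letterSign c) n := by
  induction n generalizing c with
  | nil => simp [tupleChar, freeChar]
  | cons m n ih =>
    rw [tupleChar, map_mul, glue_altChar, ih, freeChar, charTail_eq, ← letterSign_nextLetter,
      ← mul_assoc]

/-! ### Values of a Brownian motion -/

/-- The value of a Brownian motion on a combination of words of degree `k`, in which the words are
replaced by the powers of `X` to form the polynomial `p`. -/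
def brownianValue (N : ℕ) (α β : ℝ) (k : ℤ) (p : Polynomial ℝ) : ℝ :=
  -(α - β / N) * p.derivative.eval (N : ℝ) - β / (N : ℝ) ^ 2 * (k : ℝ) ^ 2 * p.eval (N : ℝ)

theorem brownianValue_sub (α β : ℝ) (k : ℤ) (p q : Polynomial ℝ) :
    brownianValue N α β k (p - q) = brownianValue N α β k p - brownianValue N α β k q := by
  simp only [brownianValue, Polynomial.derivative_sub, Polynomial.eval_sub]
  ring

/-- The degree of a word. -/
def wordDegree (w : List Bool) : ℤ := w.count true - w.count false

theorem wordDegree_append_singleton (w : List Bool) (c : Bool) :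
    wordDegree (w ++ [c]) = wordDegree w + letterSign c := by
  cases c <;> simp [wordDegree, letterSign] <;> ring

/-- The `-ℓ` inside `k² - ℓ` contributes `ℓ N^(ℓ-1) β/N`, which joins the `α` term as a multiple of
the derivative of `X ^ ℓ` at `N`. -/
theorem IsBrownianMotion.apply_wordChar {α β : ℝ} {L : OU N →ₗ[ℂ] ℂ} (hL : IsBrownianMotion α β L)
    (hN : N ≠ 0) (w : List Bool) :
    L (wordChar N w) = (brownianValue N α β (wordDegree w) (Polynomial.X ^ w.length) : ℝ) := by
  have hN' : (N : ℂ) ≠ 0 := Nat.cast_ne_zero.2 hN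
  rw [hL.apply_word, brownianValue, wordDegree, Polynomial.derivative_X_pow]
  generalize w.length = l
  cases l with
  -- Here the exponent `ℓ - 1` is `-1` on one side and truncates to `0` in the derivative; both
  -- powers have coefficient `0`.
  | zero =>
    simp
    field_simp
  | succ l =>
    push_cast
    rw [zpow_sub₀ hN', zpow_sub₀ hN', zpow_add_one₀ hN']
    simp
    field_simp
    ring

/-- `a` behaves, under `L`, like a combination of words of degree `k` with polynomial `p`. -/
def HasSymbol (α β : ℝ) (L : OU N →ₗ[ℂ] ℂ) (a : OU N) (k : ℤ) (p : Polynomial ℝ) : Prop :=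
  ∀ w : List Bool, L (wordChar N w * a) =
    (brownianValue N α β (wordDegree w + k) (Polynomial.X ^ w.length * p) : ℝ)

section
variable {α β : ℝ} {L : OU N →ₗ[ℂ] ℂ} {a b : OU N} {k : ℤ} {p q : Polynomial ℝ}

theorem IsBrownianMotion.hasSymbol_one (hL : IsBrownianMotion α β L) (hN : N ≠ 0) :
    HasSymbol α β L 1 0 1 := fun w => by
  rw [mul_one, add_zero, mul_one, hL.apply_wordChar hN]

/-- The arbitrary prefix `w` in `HasSymbol` serves here: the new letter is absorbed into it. -/
theorem HasSymbol.letterChar_mul (h : HasSymbol α β L a k p) (c : Bool) :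
    HasSymbol α β L (letterChar N c * a) (letterSign c + k) (Polynomial.X * p) := fun w => by
  rw [← mul_assoc, ← wordChar_append_singleton, h, wordDegree_append_singleton, add_assoc,
    List.length_append, List.length_singleton, pow_succ, mul_assoc]

/-- `brownianValue` is linear in the polynomial but quadratic in the degree, hence the common `k`.
-/
theorem HasSymbol.sub (ha : HasSymbol α β L a k p) (hb : HasSymbol α β L b k q) :
    HasSymbol α β L (a - b) k (p - q) := fun w => by
  rw [mul_sub, map_sub, ha, hb, mul_sub, brownianValue_sub, Complex.ofReal_sub]

theorem HasSymbol.altChar_mul (h : HasSymbol α β L a k p) : ∀ (c : Bool) (m : ℕ),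
    HasSymbol α β L (altChar N c m * a) ((if Odd m then letterSign c else 0) + k)
      (Polynomial.Chebyshev.S ℝ m * p)
  | c, 0 => by simpa [altChar] using h
  | c, 1 => by simpa [altChar] using h.letterChar_mul c
  | c, m + 2 => by
    have h1 := (h.altChar_mul (!c) (m + 1)).letterChar_mul c
    have h2 := h.altChar_mul c m
    -- The signs of `c` and `!c` cancel, so the two terms of the recursion have equal degree.
    have hk : letterSign c + ((if Odd (m + 1) then letterSign !c else 0) + k) =
        (if Odd m then letterSign c else 0) + k := by
      by_cases hm : Odd m <;> simp [hm, Nat.odd_add_one, letterSign_not]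
    rw [hk] at h1
    have hm : Odd (m + 2) ↔ Odd m := by simp [Nat.odd_add_one]
    have h3 := h1.sub h2
    simp only [hm]
    push_cast at h3 ⊢
    rwa [← mul_assoc, ← mul_assoc, ← sub_mul, ← sub_mul, ← Polynomial.Chebyshev.S_add_two,
      ← altChar] at h3

end

/-- The degree in `z` of the character attached to a tuple. -/
def tupleDegree : Bool → List ℕ → ℤ
  | _, [] => 0
  | c, m :: n => (if Odd m then letterSign c else 0) + tupleDegree (nextLetter c m) n

theorem IsBrownianMotion.hasSymbol_tupleChar {α β : ℝ} {L : OU N →ₗ[ℂ] ℂ}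
    (hL : IsBrownianMotion α β L) (hN : N ≠ 0) (c : Bool) (n : List ℕ) :
    HasSymbol α β L (tupleChar N c n) (tupleDegree c n) (chebProd n) := by
  induction n generalizing c with
  | nil => exact hL.hasSymbol_one hN
  | cons m n ih => exact (ih (nextLetter c m)).altChar_mul c m

/-! ### The parity entanglement -/

/-- The alternating sum `∑ i, (-1) ^ (k_i + i)`. -/
def alternatingSum (l : List ℕ) : ℤ := ∑ i : Fin l.length, (-1) ^ (l.get i + (i : ℕ))

/-- Positions move by one while indices stay, so every sign flips; with `0` prepended, indices move
too and the signs of the old terms are kept. -/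
theorem alternatingSum_map_succ (l : List ℕ) :
    alternatingSum (l.map Nat.succ) = -alternatingSum l := by
  unfold alternatingSum
  rw [← Finset.sum_neg_distrib]
  refine Fintype.sum_equiv (finCongr (List.length_map ..)) _ _ fun i => ?_
  simp [pow_succ, pow_add]

theorem alternatingSum_zero_cons_map_succ (l : List ℕ) :
    alternatingSum (0 :: l.map Nat.succ) = 1 + alternatingSum l := by
  have h := alternatingSum_map_succ l
  unfold alternatingSum at h ⊢
  refine (Fin.sum_univ_succ _).trans ?_
  rw [← neg_eq_iff_eq_neg.2 h, ← Finset.sum_neg_distrib]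
  simp [pow_succ, ← add_assoc]

theorem oddPositions_cons (m : ℕ) (n : List ℕ) : oddPositions (m :: n) =
    if Odd m then 0 :: (oddPositions n).map Nat.succ else (oddPositions n).map Nat.succ := by
  unfold oddPositions
  rw [List.length_cons, List.range_succ_eq_map, List.filter_cons, List.filter_map]
  simp only [List.getD_cons_zero, decide_eq_true_eq]
  rfl

theorem length_oddPositions (n : List ℕ) : (oddPositions n).length = numOdd n := by
  induction n with
  | nil => rfl
  | cons m n ih =>
    rw [oddPositions_cons, numOdd, List.countP_cons, ← numOdd, ← ih]
    by_cases h : Odd m <;> simp [h]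

/-- An even entry flips the running sign and shifts only the positions; an odd entry keeps the sign,
contributes it, and shifts positions and indices alike. -/
theorem tupleDegree_eq (c : Bool) (n : List ℕ) :
    tupleDegree c n = letterSign c * alternatingSum (oddPositions n) := by
  induction n generalizing c with
  | nil => exact (mul_zero _).symm
  | cons m n ih =>
    rw [tupleDegree, ih, oddPositions_cons, letterSign_nextLetter]
    by_cases h : Odd m
    · rw [if_pos h, if_pos h, alternatingSum_zero_cons_map_succ, h.add_one.neg_one_pow]
      ring
    · rw [if_neg h, if_neg h, alternatingSum_map_succ,
        (Nat.not_odd_iff_even.1 h).add_one.neg_one_pow]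
      ring

theorem sq_sum_fin_eq {n : ℕ} (f : Fin n → ℤ) :
    (∑ i, f i) ^ 2 = ∑ i, f i ^ 2 + 2 * ∑ j, ∑ i, if i < j then f i * f j else 0 := by
  have h : ∀ i j, f i * f j = (if i = j then f i ^ 2 else 0) + (if i < j then f i * f j else 0) +
      if j < i then f i * f j else 0 := by
    intro i j
    rcases lt_trichotomy i j with h | rfl | h
    · simp [h, h.ne, h.not_gt]
    · simp [sq]
    · simp [h, h.ne', h.not_gt]
  rw [sq, Finset.sum_mul_sum]
  refine (Finset.sum_congr rfl fun i _ => Finset.sum_congr rfl fun j _ => h i j).trans ?_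
  simp only [Finset.sum_add_distrib]
  rw [two_mul, add_assoc]
  congr 1
  · simp
  · congr 1
    · exact Finset.sum_comm
    · exact Finset.sum_congr rfl fun i _ => Finset.sum_congr rfl fun j _ => by rw [mul_comm]

theorem oddPositions_pairwise_lt (n : List ℕ) : (oddPositions n).Pairwise (· < ·) :=
  List.pairwise_lt_range.filter _

theorem sq_alternatingSum_oddPositions (n : List ℕ) :
    alternatingSum (oddPositions n) ^ 2 = numOdd n + 2 * entanglement n := by
  unfold alternatingSum entanglement
  rw [sq_sum_fin_eq, ← length_oddPositions]
  congr 1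
  · have h : ∀ k : ℕ, (((-1) ^ k) ^ 2 : ℤ) = 1 := fun k => by
      rw [← pow_mul, mul_comm, pow_mul, neg_one_sq, one_pow]
    simp only [h, Finset.sum_const, Finset.card_univ, Fintype.card_fin, nsmul_one]
  · congr 1
    refine Finset.sum_congr rfl fun j _ => Finset.sum_congr rfl fun i _ => ?_
    split_ifs with hij
    · have hlt : (oddPositions n).get i < (oddPositions n).get j :=
        List.pairwise_iff_get.1 (oddPositions_pairwise_lt n) i j hij
      have hij' : (i : ℕ) < j := hij
      rw [← pow_add]
      apply neg_one_pow_congr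
      -- Sum and difference of the exponents have the same parity; the subtraction is exact because
      -- the positions increase.
      have : (oddPositions n).get j + (j : ℕ) - ((oddPositions n).get i + (i : ℕ)) +
          2 * ((oddPositions n).get i + (i : ℕ)) =
          (oddPositions n).get i + i + ((oddPositions n).get j + j) := by omega
      rw [← this, Nat.even_add]
      simp
    · rfl

theorem sq_tupleDegree (c : Bool) (n : List ℕ) :
    tupleDegree c n ^ 2 = numOdd n + 2 * entanglement n := by
  rw [tupleDegree_eq, mul_pow, letterSign_sq, one_mul, sq_alternatingSum_oddPositions]

theorem IsBrownianMotion.apply_tupleChar {α β : ℝ} {L : OU N →ₗ[ℂ] ℂ}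
    (hL : IsBrownianMotion α β L) (hN : N ≠ 0) (c : Bool) (n : List ℕ) :
    L (tupleChar N c n) = ((-(α - β / N) * (chebProd n).derivative.eval (N : ℝ)
        - β * (((numOdd n : ℝ) + 2 * (entanglement n : ℝ)) / (N : ℝ) ^ 2)
          * (chebProd n).eval (N : ℝ) : ℝ) : ℂ) := by
  -- The empty prefix yields the value on the character itself.
  have h := hL.hasSymbol_tupleChar hN c n []
  have hd : ((tupleDegree c n : ℝ)) ^ 2 = numOdd n + 2 * entanglement n := by
    exact_mod_cast sq_tupleDegree c n
  rw [wordChar_eq_prod, List.map_nil, List.prod_nil, one_mul, List.length_nil, pow_zero, one_mul,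
    brownianValue] at h
  rw [h]
  congr 1
  rw [show wordDegree [] + tupleDegree c n = tupleDegree c n by simp [wordDegree], hd]
  ring

end

end FreeUnitary

theorem mainTheorem3 (N : ℕ) (hN : 1 ≤ N) (α β : ℝ) (L : FreeUnitary.OU N →ₗ[ℂ] ℂ)
    (hL : FreeUnitary.IsBrownianMotion α β L)
    (n : List ℕ) (hn : n ≠ []) (hpos : ∀ m ∈ n, 1 ≤ m) (ε : ℤ) (hε : ε = 1 ∨ ε = -1) :
    (∃! x : FreeUnitary.OU N, FreeUnitary.glue N x = FreeUnitary.freeChar N ε n) ∧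
    ∀ x : FreeUnitary.OU N, FreeUnitary.glue N x = FreeUnitary.freeChar N ε n →
      L x = ((-(α - β / N) * (FreeUnitary.chebProd n).derivative.eval (N : ℝ)
        - β * (((FreeUnitary.numOdd n : ℝ) + 2 * (FreeUnitary.entanglement n : ℝ)) / (N : ℝ) ^ 2)
          * (FreeUnitary.chebProd n).eval (N : ℝ) : ℝ) : ℂ) := by
  obtain ⟨c, rfl⟩ : ∃ c, FreeUnitary.letterSign c = ε := by
    rcases hε with rfl | rfl
    · exact ⟨true, rfl⟩
    · exact ⟨false, rfl⟩
  have hc := FreeUnitary.glue_tupleChar (N := N) c n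
  have huniq : ∀ x, FreeUnitary.glue N x = FreeUnitary.freeChar N (FreeUnitary.letterSign c) n →
      x = FreeUnitary.tupleChar N c n :=
    fun x hx => FreeUnitary.glue_injective N (hx.trans hc.symm)
  refine ⟨⟨_, hc, huniq⟩, fun x hx => ?_⟩
  rw [huniq x hx, hL.apply_tupleChar (by omega)]
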